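/- Let $V$ be a countable set, let $b:V\times V\to[0,\infty)$ and $m:V\to(0,\infty)$ be weights with $b(x,x)=0$ for all $x$, and regard $(x,y)$ as a directed edge iff $b(x,y)>0$. Assume that this directed graph is locally finite (for every $x$ only finitely many $y$ satisfy $b(x,y)>0$ or $b(y,x)>0$), that it is connected (for any two vertices there is a directed path from at least one of them to the other), and that every vertex is the origin of at least one edge. On the Hilbert space $\ell^2(V,m)=\{f:V\to\mathbb C:\ \sum_x m(x)|f(x)|^2<\infty\}$ with scalar product $(f,g)_m=\sum_x m(x)f(x)\overline{g(x)}$ consider the operators with domain the finitely supported functions $\mathcal C_c(V)$, $$\Delta f(x)=\frac1{m(x)}\sum_{y\in V}b(x,y)\,(f(x)-f(y)),\qquad \Delta' f(x)=\frac1{m(x)}\sum_{y\in V}b(y,x)\,(f(x)-f(y)),\qquad H=\tfrac12(\Delta+\Delta').$$ Assume: (β) $\sum_{y}b(x,y)=\sum_{y}b(y,x)$ for all $x\in V$; (γ) there is $M>0$ with $\sum_{y}|b(x,y)-b(y,x)|\le M\,m(x)$ for all $x\in V$; and that $H$ is essentially self-adjoint (its closure is self-adjoint). Let $\Delta^*$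 be the Hilbert space adjoint of $\Delta$. Then $\Delta$ is closable and, with $\overline\Delta$ its closure and $S=\tfrac12(\overline\Delta+\Delta^*)$ on the domain $D(\overline\Delta)\cap D(\Delta^*)$, $$\eta^{ess}(\overline\Delta)\ \ge\ \inf\sigma_{ess}(S).$$ Here $\sigma_{ess}(A)$ is the set of all $\lambda\in\mathbb C$ such that the range of $A-\lambda$ is not closed or $\dim\ker(A-\lambda)=\infty$, $\eta^{ess}(A)=\inf\{\operatorname{Re}\lambda:\lambda\in\sigma_{ess}(A)\}$, $\inf\sigma_{ess}(S)$ is the infimum of the real numbers in $\sigma_{ess}(S)$, and infima are taken in $[-\infty,+\infty]$, so that $\inf\emptyset=+\infty$. -/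

import Mathlib

noncomputable section

/-- A locally finite directed weighted graph without loops on the vertex set `V`: the edge weight
`b` (there is a directed edge from `x` to `y` iff `b x y > 0`) and the vertex weight `m`. -/
structure WeightedDigraph (V : Type*) where
  b : V → V → ℝ
  m : V → ℝ
  b_nonneg : ∀ x y, 0 ≤ b x y
  b_self : ∀ x, b x x = 0
  m_pos : ∀ x, 0 < m x
  locallyFinite : ∀ x, {y | 0 < b x y ∨ 0 < b y x}.Finite

namespace WeightedDigraph

variable {V : Type*} (G : WeightedDigraph V)

/-- `(x, y)` is a directed edge. -/
def Edge (x y : V) : Prop := 0 < G.b x y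

/-- Any two vertices are related by a (directed) path, in at least one of the two directions. -/
def Connected : Prop :=
  ∀ x y, Relation.ReflTransGen G.Edge x y ∨ Relation.ReflTransGen G.Edge y x

/-- Every vertex is the origin of an edge. -/
def HasOutEdges : Prop := ∀ x, ∃ y, G.Edge x y

/-- Kirchhoff's law `β⁺ = β⁻`. -/
def AssumptionBeta : Prop := ∀ x, ∑' y, G.b x y = ∑' y, G.b y x

/-- The asymmetry of the edge weight is controlled by the vertex weight. -/
def AssumptionGamma : Prop := ∃ M : ℝ, 0 < M ∧ ∀ x, ∑' y, |G.b x y - G.b y x| ≤ M * G.m x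

/-! ### The Hilbert space `ℓ²(V, m)` -/

lemma mem_l2_iff (f : V → ℂ) : (Summable fun x => G.m x * ‖f x‖ ^ 2) ↔
    Memℓp (fun x => (Real.sqrt (G.m x) : ℂ) * f x) 2 := by
  rw [memℓp_gen_iff (by norm_num)]
  refine summable_congr fun x => ?_
  simp [mul_pow, abs_of_nonneg, Real.sqrt_nonneg, Real.sq_sqrt (G.m_pos x).le]

/-- The functions `f : V → ℂ` with `∑ x, m x * |f x| ^ 2 < ∞`. -/
def l2Submodule : Submodule ℂ (V → ℂ) where
  carrier := {f | Summable fun x => G.m x * ‖f x‖ ^ 2}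
  zero_mem' := by simp [summable_zero]
  add_mem' {f g} hf hg := by
    have hf' := (G.mem_l2_iff f).1 hf
    have hg' := (G.mem_l2_iff g).1 hg
    refine (G.mem_l2_iff _).2 ?_
    convert hf'.add hg' using 1
    ext x
    simp [mul_add]
  smul_mem' c f hf := by
    have hf' := (G.mem_l2_iff f).1 hf
    refine (G.mem_l2_iff _).2 ?_
    convert hf'.const_smul c using 1
    ext x
    simp [mul_left_comm]

/-- The space `ℓ²(V, m)`. -/
def L2 : Type _ := G.l2Submodule

instance : AddCommGroup G.L2 := inferInstanceAs (AddCommGroup G.l2Submodule)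

instance : Module ℂ G.L2 := inferInstanceAs (Module ℂ G.l2Submodule)

instance : FunLike G.L2 V ℂ where
  coe f := f.1
  coe_injective _ _ h := Subtype.ext h

variable {G}

@[ext] lemma L2.ext {f g : G.L2} (h : ∀ x, f x = g x) : f = g := DFunLike.ext _ _ h

@[simp] lemma L2.zero_apply (x : V) : (0 : G.L2) x = 0 := rfl

@[simp] lemma L2.add_apply (f g : G.L2) (x : V) : (f + g) x = f x + g x := rfl

@[simp] lemma L2.smul_apply (c : ℂ) (f : G.L2) (x : V) : (c • f) x = c * f x := rfl

/-- An element of `ℓ²(V, m)` from a function and a proof of square summability. -/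
def L2.mk (f : V → ℂ) (hf : Summable fun x => G.m x * ‖f x‖ ^ 2) : G.L2 := ⟨f, hf⟩

@[simp] lemma L2.mk_apply (f : V → ℂ) (hf : Summable fun x => G.m x * ‖f x‖ ^ 2) (x : V) :
    (L2.mk f hf : G.L2) x = f x := rfl

lemma L2.summable (f : G.L2) : Summable fun x => G.m x * ‖f x‖ ^ 2 := f.2

variable (G)

/-- Multiplication by `√m`, an isomorphism from `ℓ²(V, m)` onto `ℓ²(V)`. -/
def L2.toLp : G.L2 ≃ₗ[ℂ] lp (fun _ : V => ℂ) 2 where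
  toFun f := ⟨fun x => (Real.sqrt (G.m x) : ℂ) * f x, (G.mem_l2_iff f).1 f.2⟩
  map_add' f g := by
    ext x
    exact mul_add _ _ _
  map_smul' c f := by
    ext x
    exact mul_left_comm _ _ _
  invFun g := L2.mk (fun x => (Real.sqrt (G.m x) : ℂ)⁻¹ * g x) <| by
    refine (G.mem_l2_iff _).2 ?_
    convert lp.memℓp g using 1
    ext x
    have : (Real.sqrt (G.m x) : ℂ) ≠ 0 := by
      exact_mod_cast (Real.sqrt_pos.2 (G.m_pos x)).ne'
    field_simp
  left_inv f := by
    ext x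
    have : (Real.sqrt (G.m x) : ℂ) ≠ 0 := by
      exact_mod_cast (Real.sqrt_pos.2 (G.m_pos x)).ne'
    simp [this]
  right_inv g := by
    ext x
    have : (Real.sqrt (G.m x) : ℂ) ≠ 0 := by
      exact_mod_cast (Real.sqrt_pos.2 (G.m_pos x)).ne'
    simp [this]

/-- The scalar product `∑ x, m x * conj (f x) * g x`, conjugate linear in the first variable as
always in Mathlib. -/
instance : Inner ℂ G.L2 where
  inner f g := ∑' x, (G.m x : ℂ) * (starRingEnd ℂ (f x) * g x)

lemma L2.inner_def (f g : G.L2) :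
    inner ℂ f g = ∑' x, (G.m x : ℂ) * (starRingEnd ℂ (f x) * g x) := rfl

lemma L2.inner_toLp (f g : G.L2) : inner ℂ f g = inner ℂ (L2.toLp G f) (L2.toLp G g) := by
  rw [L2.inner_def, lp.inner_eq_tsum]
  refine tsum_congr fun x => ?_
  have h : (Real.sqrt (G.m x) : ℂ) * Real.sqrt (G.m x) = G.m x := by
    exact_mod_cast Real.mul_self_sqrt (G.m_pos x).le
  simp only [L2.toLp, LinearEquiv.coe_mk, LinearMap.coe_mk, AddHom.coe_mk, RCLike.inner_apply,
    map_mul, Complex.conj_ofReal]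
  rw [← h]
  ring

/-- The axioms of a scalar product. -/
@[reducible] def L2.core : InnerProductSpace.Core ℂ G.L2 where
  inner f g := inner ℂ f g
  conj_inner_symm f g := by simp only [L2.inner_toLp]; exact inner_conj_symm _ _
  re_inner_nonneg f := by simp only [L2.inner_toLp]; exact inner_self_nonneg (𝕜 := ℂ)
  add_left f g h := by simp only [L2.inner_toLp, map_add]; exact inner_add_left _ _ _
  smul_left f g c := by simp only [L2.inner_toLp, map_smul]; exact inner_smul_left _ _ _
  definite f hf := by
    rw [L2.inner_toLp] at hf
    exact (L2.toLp G).map_eq_zero_iff.1 (inner_self_eq_zero.1 hf)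

instance : NormedAddCommGroup G.L2 := (L2.core G).toNormedAddCommGroup

instance : InnerProductSpace ℂ G.L2 := InnerProductSpace.ofCore (L2.core G).toCore

/-- `ℓ²(V, m)` is isometric to `ℓ²(V)`. -/
def L2.isometryLp : G.L2 ≃ₗᵢ[ℂ] lp (fun _ : V => ℂ) 2 :=
  (L2.toLp G).isometryOfInner fun f g => (L2.inner_toLp G f g).symm

instance : CompleteSpace G.L2 :=
  (L2.isometryLp G).toIsometryEquiv.completeSpace

/-! ### The Laplacians -/

/-- The finitely supported functions, as a subspace of `ℓ²(V, m)`. -/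
def finSupp : Submodule ℂ G.L2 where
  carrier := {f | (Function.support f).Finite}
  zero_mem' := by simp [Function.support]
  add_mem' {f g} hf hg := (hf.union hg).subset (Function.support_add (f := f) (g := g))
  smul_mem' c f hf := hf.subset fun x hx hfx => hx (by simp [hfx])

lemma mem_finSupp {f : G.L2} : f ∈ G.finSupp ↔ (Function.support f).Finite := Iff.rfl

/-- For an edge weight `w`, the function `x ↦ (1 / m x) * ∑ y, w x y * (f x - f y)`. -/
def lapFun (w : V → V → ℝ) (f : V → ℂ) (x : V) : ℂ :=
  1 / (G.m x : ℂ) * ∑' y, (w x y : ℂ) * (f x - f y)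

lemma lapFun_support {w : V → V → ℝ} (hw : ∀ x, {y | w x y ≠ 0 ∨ w y x ≠ 0}.Finite)
    {f : V → ℂ} (hf : (Function.support f).Finite) :
    (Function.support (G.lapFun w f)).Finite := by
  refine (hf.union (hf.biUnion fun y _ => hw y)).subset fun x hx => ?_
  by_contra hcon
  simp only [Set.mem_union, Set.mem_iUnion, not_or, not_exists] at hcon
  obtain ⟨h1, h2⟩ := hcon
  refine hx ?_
  have h1' : f x = 0 := by simpa using h1
  have : ∀ y, (w x y : ℂ) * (f x - f y) = 0 := fun y => by
    by_cases hy : f y = 0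
    · simp [h1', hy]
    · have := h2 y hy
      simp only [Set.mem_ofPred_eq, not_or, not_not] at this
      simp [this.2]
  simp [lapFun, this]

lemma summable_of_support_finite {f : V → ℂ} (hf : (Function.support f).Finite) :
    Summable fun x => G.m x * ‖f x‖ ^ 2 :=
  summable_of_hasFiniteSupport (hf.subset fun x hx hfx => hx (by simp [hfx]))

lemma lapFun_summable {w : V → V → ℝ} (hw : ∀ x, {y | w x y ≠ 0 ∨ w y x ≠ 0}.Finite)
    (f : V → ℂ) (x : V) : Summable fun y => (w x y : ℂ) * (f x - f y) :=
  summable_of_hasFiniteSupport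
    ((hw x).subset fun y hy => Or.inl fun h => hy (by simp [h]))

lemma lapFun_add {w : V → V → ℝ} (hw : ∀ x, {y | w x y ≠ 0 ∨ w y x ≠ 0}.Finite)
    (f g : V → ℂ) (x : V) : G.lapFun w (f + g) x = G.lapFun w f x + G.lapFun w g x := by
  simp only [lapFun]
  have h := Summable.tsum_add (lapFun_summable hw f x) (lapFun_summable hw g x)
  rw [← mul_add, ← h]
  congr 1
  exact tsum_congr fun y => by simp only [Pi.add_apply]; ring

lemma lapFun_smul (w : V → V → ℝ) (c : ℂ) (f : V → ℂ) (x : V) :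
    G.lapFun w (c • f) x = c * G.lapFun w f x := by
  simp only [lapFun]
  rw [mul_left_comm, ← tsum_mul_left (a := c)]
  congr 1
  exact tsum_congr fun y => by simp only [Pi.smul_apply, smul_eq_mul]; ring

/-- The operator `f ↦ lapFun w f` on `ℓ²(V, m)`, with the finitely supported functions as
domain. -/
def laplacianOf (w : V → V → ℝ) (hw : ∀ x, {y | w x y ≠ 0 ∨ w y x ≠ 0}.Finite) :
    G.L2 →ₗ.[ℂ] G.L2 where
  domain := G.finSupp
  toFun :=
    { toFun := fun f => L2.mk (G.lapFun w f.1)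
        (G.summable_of_support_finite (G.lapFun_support hw (G.mem_finSupp.1 f.2)))
      map_add' := fun f g => L2.ext fun x => G.lapFun_add hw f.1 g.1 x
      map_smul' := fun c f => L2.ext fun x => G.lapFun_smul w c f.1 x }

lemma finite_weight (x : V) : {y | G.b x y ≠ 0 ∨ G.b y x ≠ 0}.Finite :=
  (G.locallyFinite x).subset fun y hy =>
    hy.imp (fun h => (G.b_nonneg x y).lt_of_ne' h) (fun h => (G.b_nonneg y x).lt_of_ne' h)

/-- The Laplacian `Δ f x = (1 / m x) * ∑ y, b x y * (f x - f y)`. -/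
def laplacian : G.L2 →ₗ.[ℂ] G.L2 := G.laplacianOf G.b G.finite_weight

/-- The formal adjoint `Δ' f x = (1 / m x) * ∑ y, b y x * (f x - f y)`. -/
def formalAdjointLaplacian : G.L2 →ₗ.[ℂ] G.L2 :=
  G.laplacianOf (fun x y => G.b y x) fun x => (G.finite_weight x).subset fun _ hy => hy.symm

/-- The symmetric operator `H = (Δ + Δ') / 2` on the finitely supported functions. -/
def opH : G.L2 →ₗ.[ℂ] G.L2 := (1 / 2 : ℂ) • (G.laplacian + G.formalAdjointLaplacian)

/-- The real part `S = (Δ̄ + Δ*) / 2` of the closure of `Δ`, on the domain `D(Δ̄) ∩ D(Δ*)`. -/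
def opS : G.L2 →ₗ.[ℂ] G.L2 := (1 / 2 : ℂ) • (G.laplacian.closure + G.laplacian.adjoint)

end WeightedDigraph

/-! ### Unbounded operators -/

namespace UnboundedOp

variable {E : Type*} [NormedAddCommGroup E] [InnerProductSpace ℂ E]

/-- An operator is essentially self-adjoint if its closure is self-adjoint. -/
def IsEssentiallySelfAdjoint [CompleteSpace E] (A : E →ₗ.[ℂ] E) : Prop :=
  IsSelfAdjoint A.closure

/-- The linear map `A - z` on the domain of `A`. -/
def shift (A : E →ₗ.[ℂ] E) (z : ℂ) : A.domain →ₗ[ℂ] E := A.toFun - z • A.domain.subtype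

/-- The essential spectrum: all `z` such that the range of `A - z` is not closed or the kernel of
`A - z` has infinite dimension. -/
def essSpectrum (A : E →ₗ.[ℂ] E) : Set ℂ :=
  {z | ¬ IsClosed (LinearMap.range (shift A z) : Set E) ∨
    ¬ FiniteDimensional ℂ (LinearMap.ker (shift A z))}

/-- `η^ess(A)`, the infimum of the real parts of the essential spectrum, an extended real number
(`+∞` if the essential spectrum is empty). -/
def etaEss (A : E →ₗ.[ℂ] E) : EReal := ⨅ z ∈ essSpectrum A, ((z.re : ℝ) : EReal)

/-- `inf σ_ess(A)` for a self-adjoint `A`, the infimum of the real numbers in the essential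
spectrum, an extended real number (`+∞` if there are none). -/
def infEss (A : E →ₗ.[ℂ] E) : EReal :=
  ⨅ r ∈ {r : ℝ | (r : ℂ) ∈ essSpectrum A}, (r : EReal)

end UnboundedOp

end

/-! On finitely supported functions `Δ = H + K` with `K = (Δ - Δ') / 2`. Kirchhoff's law (β) cancels
the diagonal of `K`, leaving an antisymmetric kernel, and (γ) makes `K` bounded by a Schur test
(`norm_skewPart_le`). So `K` extends to a bounded skew-adjoint operator, and with `H̄` self-adjoint
this gives `Δ̄ = H̄ + K`, `Δ* = H̄ - K`, `S = H̄ ≥ 0`, and `Re (Δ̄ f, f) = (S f, f)`.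

The rest is abstract (`infEss_le_etaEss`). A point `z` is outside the essential spectrum of a closed
operator iff the operator minus `z` is bounded below on the orthogonal complement of some
finite-dimensional space. Hence `z ∈ σ_ess(Δ̄)` yields, in every space of finite codimension, unit
vectors with `(S f, f) ≤ Re z + c` for any `c > 0`. It remains to find a point of `σ_ess(S)` below
`Re z`, and this is done without the spectral theorem: such vectors satisfy `(R f, f) ≥ 1 / (1 + Re
z + c)` for `R = (S + 1)⁻¹`, a variational argument (`exists_approx_eigenvalue`) produces
approximate eigenvectors of `R` for some `q ≥ 1 / (1 + Re z)`, and `1 / q - 1` lies in `σ_ess(S)`.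
-/

noncomputable section

namespace UnboundedOp

variable {E : Type*} [NormedAddCommGroup E] [InnerProductSpace ℂ E]

/-! ### The essential spectrum of a closed operator -/

/-- The part of the graph of `A` that lies over the orthogonal complement of `F`. -/
def graphOver (A : E →ₗ.[ℂ] E) (F : Submodule ℂ E) : Submodule ℂ (E × E) :=
  A.graph ⊓ Fᗮ.comap (LinearMap.fst ℂ E E)

/-- The map `(x, y) ↦ y - z • x` on the part of the graph over the complement of `F`. -/
def graphShift (A : E →ₗ.[ℂ] E) (F : Submodule ℂ E) (z : ℂ) : graphOver A F →L[ℂ] E :=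
  (ContinuousLinearMap.snd ℂ E E - z • ContinuousLinearMap.fst ℂ E E) ∘L (graphOver A F).subtypeL

@[simp] lemma graphShift_apply (A : E →ₗ.[ℂ] E) (F : Submodule ℂ E) (z : ℂ) (p : graphOver A F) :
    graphShift A F z p = p.1.2 - z • p.1.1 := rfl

lemma isClosed_graphOver {A : E →ₗ.[ℂ] E} (hA : A.IsClosed) (F : Submodule ℂ E) :
    IsClosed (graphOver A F : Set (E × E)) :=
  IsClosed.inter hA (F.isClosed_orthogonal.preimage continuous_fst)

lemma completeSpace_graphOver [CompleteSpace E] {A : E →ₗ.[ℂ] E} (hA : A.IsClosed)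
    (F : Submodule ℂ E) : CompleteSpace (graphOver A F) :=
  (isClosed_graphOver hA F).completeSpace_coe

/-- Outside of the essential spectrum, `A - z` is bounded below on the orthogonal complement of a
finite-dimensional space. -/
lemma exists_bound_of_notMem_essSpectrum [CompleteSpace E] {A : E →ₗ.[ℂ] E} (hA : A.IsClosed)
    {z : ℂ} (hz : z ∉ essSpectrum A) :
    ∃ F : Submodule ℂ E, FiniteDimensional ℂ F ∧ ∃ c : ℝ, 0 < c ∧
      ∀ p ∈ A.graph, p.1 ∈ Fᗮ → c * ‖p.1‖ ≤ ‖p.2 - z • p.1‖ := by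
  simp only [essSpectrum, Set.mem_ofPred_eq, not_or, not_not] at hz
  obtain ⟨hcl, hfin⟩ := hz
  set F := (LinearMap.ker (shift A z)).map A.domain.subtype with hF
  have hFfin : FiniteDimensional ℂ F := inferInstance
  have := completeSpace_graphOver hA F
  have hker : ∀ x : A.domain, shift A z x = 0 → (x : E) ∈ F := fun x hx =>
    Submodule.mem_map_of_mem (f := A.domain.subtype) (LinearMap.mem_ker.2 hx)
  have hinj : Function.Injective (graphShift A F z) := by
    rw [injective_iff_map_eq_zero]
    rintro ⟨⟨x, y⟩, hxy, hx⟩ h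
    obtain ⟨x', rfl, rfl⟩ := A.mem_graph_iff.1 hxy
    have h1 := hker x' h
    have h2 : (x' : E) = 0 := by
      simpa using (Submodule.mem_orthogonal _ _).1 hx _ h1
    have h3 : x' = 0 := Subtype.ext h2
    subst h3
    simp
  have hrange : Set.range (graphShift A F z) = (LinearMap.range (shift A z) : Set E) := by
    ext w
    constructor
    · rintro ⟨⟨⟨x, y⟩, hxy, hx⟩, rfl⟩
      obtain ⟨x', rfl, rfl⟩ := A.mem_graph_iff.1 hxy
      exact ⟨x', rfl⟩
    · rintro ⟨x, rfl⟩
      -- The projection of `x` onto `F` is in the kernel, hence in the domain; subtracting it leaves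
      -- the value of `A - z` unchanged.
      obtain ⟨k, hk, hkx⟩ := F.starProjection_apply_mem (x : E)
      have hmem : ((x - k : A.domain) : E) ∈ Fᗮ := by
        have := F.sub_starProjection_mem_orthogonal (x : E)
        rwa [← hkx] at this
      refine ⟨⟨((x - k : A.domain), A (x - k)), A.mem_graph _, hmem⟩, ?_⟩
      change shift A z (x - k) = _
      rw [map_sub, LinearMap.mem_ker.1 hk, sub_zero]
  obtain ⟨K, hK⟩ := (graphShift A F z).antilipschitz_of_injective_of_isClosed_range hinj
    (by rw [hrange]; exact hcl)
  -- The summand `1` covers the case `K = 0`.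
  refine ⟨F, hFfin, ((K : ℝ) + 1)⁻¹, by positivity, fun p hp hpF => ?_⟩
  have h := ZeroHomClass.bound_of_antilipschitz (graphShift A F z) hK ⟨p, hp, hpF⟩
  have h1 : ‖p.1‖ ≤ K * ‖p.2 - z • p.1‖ := (norm_fst_le p).trans h
  rw [inv_mul_le_iff₀ (by positivity)]
  nlinarith [norm_nonneg (p.2 - z • p.1)]

/-- If `A - z` is bounded below on the orthogonal complement of a finite-dimensional space, then
`z` is not in the essential spectrum. -/
lemma notMem_essSpectrum_of_bound [CompleteSpace E] {A : E →ₗ.[ℂ] E} (hA : A.IsClosed)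
    {z : ℂ} (F : Submodule ℂ E) [FiniteDimensional ℂ F] {c : ℝ} (hc : 0 < c)
    (h : ∀ p ∈ A.graph, p.1 ∈ Fᗮ → c * ‖p.1‖ ≤ ‖p.2 - z • p.1‖) : z ∉ essSpectrum A := by
  simp only [essSpectrum, Set.mem_ofPred_eq, not_or, not_not]
  let P : A.domain →ₗ[ℂ] F := F.orthogonalProjectionOnto.toLinearMap ∘ₗ A.domain.subtype
  have hP : ∀ x : A.domain, P x = 0 ↔ (x : E) ∈ Fᗮ := fun x =>
    F.orthogonalProjectionOnto_eq_zero_iff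
  constructor
  · have := completeSpace_graphOver hA F
    -- `F` need not lie in the domain, so the domain is split algebraically: `P` is injective on
    -- `C`, which is therefore finite-dimensional and adds only a finite-dimensional space to the
    -- closed range over `Fᗮ`.
    obtain ⟨C, hC⟩ := (LinearMap.ker P).exists_isCompl
    have hCfin : FiniteDimensional ℂ C := by
      refine Module.Finite.of_injective (P ∘ₗ C.subtype) ?_
      rw [injective_iff_map_eq_zero]
      intro x hx
      have := Submodule.disjoint_def.1 hC.disjoint x.1 hx x.2
      exact Subtype.ext this
    have hanti : AntilipschitzWith (Real.toNNReal (c⁻¹ * (1 + ‖z‖) + 1)) (graphShift A F z) := by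
      refine ContinuousLinearMap.antilipschitz_of_bound _ ?_
      rintro ⟨⟨x, y⟩, hxy, hx⟩
      rw [Real.coe_toNNReal _ (by positivity)]
      have h1 : c * ‖x‖ ≤ ‖y - z • x‖ := h _ hxy hx
      have h2 : ‖x‖ ≤ c⁻¹ * ‖y - z • x‖ := by
        rwa [← div_eq_inv_mul, le_div_iff₀' hc]
      have h3 : ‖y‖ ≤ ‖y - z • x‖ + ‖z‖ * ‖x‖ := by
        rw [← norm_smul]
        simpa using norm_add_le (y - z • x) (z • x)
      have h4 := mul_le_mul_of_nonneg_left h2 (norm_nonneg z)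
      have h5 : 0 ≤ c⁻¹ * ‖y - z • x‖ := by positivity
      have h6 := mul_nonneg (norm_nonneg z) h5
      have h7 := norm_nonneg (y - z • x)
      change max ‖x‖ ‖y‖ ≤ _ * ‖y - z • x‖
      refine max_le ?_ ?_ <;> nlinarith
    have hcl := hanti.isClosed_range (graphShift A F z).uniformContinuous
    have heq : LinearMap.range (shift A z) =
        LinearMap.range (graphShift A F z).toLinearMap ⊔ C.map (shift A z) := by
      rw [LinearMap.range_eq_map, ← hC.sup_eq_top, Submodule.map_sup]
      congr 1
      ext w
      constructor
      · rintro ⟨x, hx, rfl⟩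
        exact ⟨⟨(x, A x), A.mem_graph x, (hP x).1 hx⟩, rfl⟩
      · rintro ⟨⟨⟨x, y⟩, hxy, hx⟩, rfl⟩
        obtain ⟨x', rfl, rfl⟩ := A.mem_graph_iff.1 hxy
        exact ⟨x', (hP x').2 hx, rfl⟩
    rw [heq]
    exact Submodule.isClosed_sup_finiteDimensional _ _ hcl
  · refine Module.Finite.of_injective (P ∘ₗ (LinearMap.ker (shift A z)).subtype) ?_
    rw [injective_iff_map_eq_zero]
    rintro ⟨x, hxk⟩ hx
    have h1 := h _ (A.mem_graph x) ((hP x).1 hx)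
    have h2 : A x - z • (x : E) = 0 := hxk
    rw [h2, norm_zero] at h1
    have h3 : (x : E) = 0 := norm_le_zero_iff.1 (by nlinarith)
    exact Subtype.ext (Subtype.ext h3)

/-! ### The resolvent of a nonnegative self-adjoint operator -/

lemma inner_graph_symm [CompleteSpace E] {A : E →ₗ.[ℂ] E} (hA : IsSelfAdjoint A) {p q : E × E}
    (hp : p ∈ A.graph) (hq : q ∈ A.graph) : inner ℂ p.2 q.1 = inner ℂ p.1 q.2 := by
  obtain ⟨x, hx1, hx2⟩ := A.mem_graph_iff.1 hp
  obtain ⟨y, hy1, hy2⟩ := A.mem_graph_iff.1 hq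
  have h := LinearPMap.adjoint_isFormalAdjoint hA.dense_domain
  rw [LinearPMap.isSelfAdjoint_def.1 hA] at h
  rw [← hx1, ← hx2, ← hy1, ← hy2]
  exact h x y

/-- `(A + 1)⁻¹` for a nonnegative self-adjoint operator `A`. -/
lemma exists_resolvent [CompleteSpace E] {A : E →ₗ.[ℂ] E} (hA : IsSelfAdjoint A)
    (hpos : ∀ p ∈ A.graph, 0 ≤ (inner ℂ p.1 p.2).re) :
    ∃ R : E →L[ℂ] E, (∀ x y, inner ℂ (R x) y = inner ℂ x (R y)) ∧
      (∀ x, 0 ≤ (inner ℂ (R x) x).re) ∧ (∀ h, (R h, h - R h) ∈ A.graph) ∧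
      ∀ p ∈ A.graph, R (p.2 + p.1) = p.1 := by
  have hcl := hA.isClosed
  have := completeSpace_graphOver hcl ⊥
  -- With `F = ⊥` this is `A + 1` on the whole graph, a complete space.
  set L := graphShift A ⊥ (-1) with hL
  have hLa : ∀ p, L p = p.1.2 + p.1.1 := fun p => by simp [hL]
  have hbd : ∀ p : graphOver A ⊥, ‖p.1.1‖ ≤ ‖L p‖ := by
    rintro ⟨⟨x, y⟩, hp, hp'⟩
    rw [hLa]
    have h1 := hpos _ hp
    have h2 : ‖x‖ ^ 2 ≤ ‖x‖ * ‖y + x‖ := by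
      have h3 : (inner ℂ x (y + x)).re = (inner ℂ x y).re + ‖x‖ ^ 2 := by
        rw [inner_add_right, inner_self_eq_norm_sq_to_K]
        norm_cast
      have h4 := (Complex.re_le_norm _).trans (norm_inner_le_norm (𝕜 := ℂ) x (y + x))
      dsimp only at h1
      linarith
    by_contra! hlt
    have h5 : 0 < ‖x‖ := (norm_nonneg _).trans_lt hlt
    dsimp only at hlt
    nlinarith
  have hanti : AntilipschitzWith 2 L := by
    refine ContinuousLinearMap.antilipschitz_of_bound _ fun p => ?_
    have h1 := hbd p
    have h2 : ‖p.1.2‖ ≤ ‖L p‖ + ‖p.1.1‖ := by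
      rw [hLa]
      simpa using norm_sub_le (p.1.2 + p.1.1) p.1.1
    have h3 := norm_nonneg (L p)
    change max ‖p.1.1‖ ‖p.1.2‖ ≤ 2 * _
    refine max_le ?_ ?_ <;> linarith
  have hclr := hanti.isClosed_range L.uniformContinuous
  have hcr : IsClosed (L.range : Set E) := hclr
  have := hcr.completeSpace_coe
  -- A vector `h` orthogonal to the range lies in `D(A*) = D(A)` with `A h = -h`, so nonnegativity
  -- forces `h = 0`.
  have hsurj : L.range = ⊤ := by
    rw [← Submodule.orthogonal_eq_bot_iff, Submodule.eq_bot_iff]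
    intro h hh
    have h1 : ∀ x : A.domain, inner ℂ (-h) (x : E) = inner ℂ h (A x) := fun x => by
      have := (Submodule.mem_orthogonal' _ _).1 hh (L ⟨(x, A x), A.mem_graph x, by simp⟩) ⟨_, rfl⟩
      rw [hLa, inner_add_right] at this
      rw [inner_neg_left]
      exact (eq_neg_of_add_eq_zero_left this).symm
    have h2 := LinearPMap.mem_adjoint_domain_of_exists h ⟨-h, h1⟩
    have h3 := LinearPMap.adjoint_apply_eq hA.dense_domain ⟨h, h2⟩ h1
    have h4 : (h, -h) ∈ A.graph := by
      rw [← LinearPMap.isSelfAdjoint_def.1 hA]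
      exact (LinearPMap.mem_graph_iff _).2 ⟨⟨h, h2⟩, rfl, h3⟩
    have h5 := hpos _ h4
    have h7 : (inner ℂ h h).re = ‖h‖ ^ 2 := inner_self_eq_norm_sq (𝕜 := ℂ) h
    rw [inner_neg_right, Complex.neg_re, h7] at h5
    have h6 : ‖h‖ ^ 2 = 0 := le_antisymm (by linarith) (sq_nonneg _)
    simpa using h6
  let e := ContinuousLinearEquiv.ofBijective L (LinearMap.ker_eq_bot.2 hanti.injective) hsurj
  let R : E →L[ℂ] E :=
    ContinuousLinearMap.fst ℂ E E ∘L (graphOver A ⊥).subtypeL ∘L (e.symm : E →L[ℂ] graphOver A ⊥)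
  have hR : ∀ h, (R h, h - R h) ∈ A.graph := fun h => by
    have h1 : L (e.symm h) = h := e.apply_symm_apply h
    rw [hLa] at h1
    have h2 : h - R h = (e.symm h).1.2 := sub_eq_of_eq_add h1.symm
    rw [h2]
    exact (e.symm h).2.1
  have hsymm : ∀ x y, inner ℂ (R x) y = inner ℂ x (R y) := fun x y => by
    have := inner_graph_symm hA (hR x) (hR y)
    simp only [inner_sub_left, inner_sub_right] at this
    linear_combination -this
  refine ⟨R, hsymm, fun x => ?_, hR, fun p hp => ?_⟩
  · have h1 := hpos _ (hR x)
    have h2 : inner ℂ (R x) x = inner ℂ (R x) (x - R x) + inner ℂ (R x) (R x) := by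
      rw [← inner_add_right, sub_add_cancel]
    rw [h2, Complex.add_re]
    exact add_nonneg h1 (inner_self_nonneg (𝕜 := ℂ))
  · have h1 : L ⟨p, hp, by simp⟩ = p.2 + p.1 := hLa _
    have h2 : e.symm (p.2 + p.1) = ⟨p, hp, by simp⟩ := by
      rw [← h1]
      exact e.symm_apply_apply _
    change (e.symm (p.2 + p.1)).1.1 = _
    rw [h2]

end UnboundedOp

end

noncomputable section

namespace UnboundedOp

variable {E : Type*} [NormedAddCommGroup E] [InnerProductSpace ℂ E]

/-! ### Comparison of essential spectra -/

lemma re_inner_self (x : E) : (inner ℂ x x).re = ‖x‖ ^ 2 := inner_self_eq_norm_sq (𝕜 := ℂ) x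

/-- The quadratic form of a symmetric operator along a real line. -/
lemma re_inner_sub_real_smul {R : E →L[ℂ] E} (hR : ∀ x y, inner ℂ (R x) y = inner ℂ x (R y))
    (x y : E) (t : ℝ) : (inner ℂ (R (x - (t : ℂ) • y)) (x - (t : ℂ) • y)).re =
      (inner ℂ (R x) x).re - 2 * t * (inner ℂ (R x) y).re + t ^ 2 * (inner ℂ (R y) y).re := by
  have h : (inner ℂ (R y) x).re = (inner ℂ (R x) y).re := by
    rw [hR y x, ← inner_conj_symm, Complex.conj_re]
  simp only [map_sub, map_smul, inner_sub_left, inner_sub_right, inner_smul_left, inner_smul_right,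
    Complex.sub_re, Complex.conj_ofReal, Complex.re_ofReal_mul, h]
  ring

/-- A nonnegative symmetric operator whose quadratic form is at least about `p` somewhere on the
unit sphere of every space of finite codimension has a point `q ≥ p` such that there are approximate
eigenvectors for `q` in every space of finite codimension. -/
lemma exists_approx_eigenvalue {R : E →L[ℂ] E} (hR : ∀ x y, inner ℂ (R x) y = inner ℂ x (R y))
    (hpos : ∀ x, 0 ≤ (inner ℂ (R x) x).re) {p : ℝ} (hp : 0 < p)
    (h : ∀ F : Submodule ℂ E, FiniteDimensional ℂ F → ∀ ε : ℝ, 0 < ε →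
      ∃ x ∈ Fᗮ, ‖x‖ = 1 ∧ p - ε ≤ (inner ℂ (R x) x).re) :
    ∃ q : ℝ, p ≤ q ∧ ∀ F : Submodule ℂ E, FiniteDimensional ℂ F → ∀ ε : ℝ, 0 < ε →
      ∃ x ∈ Fᗮ, ‖x‖ = 1 ∧ ‖R x - (q : ℂ) • x‖ ≤ ε := by
  -- The supremum of these levels plays the role of the top of the essential spectrum of `R`.
  let Q : Set ℝ := {t | ∀ F : Submodule ℂ E, FiniteDimensional ℂ F →
    ∃ x ∈ Fᗮ, ‖x‖ = 1 ∧ t ≤ (inner ℂ (R x) x).re}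
  have hbdd : BddAbove Q := by
    refine ⟨‖R‖, fun t ht => ?_⟩
    obtain ⟨x, -, hx1, hx⟩ := ht ⊥ inferInstance
    refine hx.trans ((Complex.re_le_norm _).trans ((norm_inner_le_norm (𝕜 := ℂ) _ _).trans ?_))
    simpa [hx1] using R.le_opNorm x
  have hmem : ∀ ε : ℝ, 0 < ε → p - ε ∈ Q := fun ε hε F hF => h F hF ε hε
  have hpq : p ≤ sSup Q := le_of_forall_sub_le fun ε hε => le_csSup hbdd (hmem ε hε)
  refine ⟨sSup Q, hpq, fun F hF ε hε => ?_⟩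
  set q := sSup Q with hq
  -- `δ` is small enough for `δ + √(2 δ (q + δ)) ≤ ε`
  obtain ⟨δ, hδ, hδ1, hδε, hδs⟩ : ∃ δ : ℝ, 0 < δ ∧ δ ≤ 1 ∧ δ ≤ ε / 2 ∧
      (q + 1) * (2 * δ) ≤ (ε / 2) ^ 2 := by
    have hq1 : 0 < q + 1 := by linarith
    refine ⟨min 1 (min (ε / 2) ((ε / 2) ^ 2 / (2 * (q + 1)))), by positivity, min_le_left _ _,
      (min_le_right _ _).trans (min_le_left _ _), ?_⟩
    have h1 : min 1 (min (ε / 2) ((ε / 2) ^ 2 / (2 * (q + 1)))) ≤ (ε / 2) ^ 2 / (2 * (q + 1)) :=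
      (min_le_right _ _).trans (min_le_right _ _)
    rw [le_div_iff₀ (by positivity)] at h1
    linarith
  obtain ⟨F₀, hF₀, hF₀'⟩ : ∃ F₀ : Submodule ℂ E, FiniteDimensional ℂ F₀ ∧
      ∀ x ∈ F₀ᗮ, ‖x‖ = 1 → (inner ℂ (R x) x).re ≤ q + δ := by
    have : q + δ ∉ Q := fun hcon => by linarith [le_csSup hbdd hcon]
    simp only [Q, Set.mem_ofPred_eq, not_forall, not_exists, not_and, not_le] at this
    obtain ⟨F₀, hF₀, h₀⟩ := this
    exact ⟨F₀, hF₀, fun x hx hx1 => (h₀ x hx hx1).le⟩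
  have hform : ∀ x ∈ F₀ᗮ, (inner ℂ (R x) x).re ≤ (q + δ) * ‖x‖ ^ 2 := fun x hx => by
    rcases eq_or_ne x 0 with rfl | hx0
    · simp
    have hn : 0 < ‖x‖ := norm_pos_iff.2 hx0
    have h1 := hF₀' (((‖x‖⁻¹ : ℝ) : ℂ) • x) (Submodule.smul_mem _ _ hx)
      (by rw [norm_smul, Complex.norm_real, norm_inv, norm_norm, inv_mul_cancel₀ hn.ne'])
    rw [map_smul, inner_smul_left, inner_smul_right, Complex.conj_ofReal, Complex.re_ofReal_mul,
      Complex.re_ofReal_mul, ← mul_assoc, ← mul_inv, inv_mul_le_iff₀ (by positivity)] at h1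
    linarith
  obtain ⟨t, ht, htq⟩ := exists_lt_of_lt_csSup ⟨_, hmem 1 one_pos⟩ (sub_lt_self q hδ)
  -- Orthogonality to `F₀` and to `R F₀` puts both `x` and `R x` into `F₀ᗮ`, where the form of `R`
  -- is at most `q + δ`.
  obtain ⟨x, hx, hx1, hxt⟩ := ht (F ⊔ (F₀ ⊔ F₀.map R.toLinearMap)) inferInstance
  rw [← Submodule.inf_orthogonal, ← Submodule.inf_orthogonal] at hx
  obtain ⟨hxF, hxF₀, hxR⟩ := hx
  refine ⟨x, hxF, hx1, ?_⟩
  have hRx : R x ∈ F₀ᗮ := fun y hy => by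
    rw [← hR]
    exact hxR _ (Submodule.mem_map_of_mem hy)
  let B : E →L[ℂ] E := ((q + δ : ℝ) : ℂ) • ContinuousLinearMap.id ℂ E - R
  have hBa : ∀ y, B y = ((q + δ : ℝ) : ℂ) • y - R y := fun y => rfl
  have hB : ∀ y z, inner ℂ (B y) z = inner ℂ y (B z) := fun y z => by
    simp only [hBa, inner_sub_left, inner_sub_right, inner_smul_left, inner_smul_right, hR,
      Complex.conj_ofReal]
  have hBf : ∀ y, (inner ℂ (B y) y).re = (q + δ) * ‖y‖ ^ 2 - (inner ℂ (R y) y).re := fun y => by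
    rw [hBa, inner_sub_left, inner_smul_left, Complex.conj_ofReal, Complex.sub_re,
      Complex.re_ofReal_mul, re_inner_self]
  have hBx : B x ∈ F₀ᗮ := Submodule.sub_mem _ (Submodule.smul_mem _ _ hxF₀) hRx
  have hC : 0 < q + δ := by linarith
  -- Cauchy-Schwarz for the form of `B`, which is nonnegative on `F₀ᗮ`: evaluating it at `x - (q +
  -- δ)⁻¹ B x` and using `B ≤ q + δ` gives `‖B x‖² ≤ (q + δ) (B x, x)`, and `(B x, x) ≤ 2 δ` by the
  -- choice of `x`.
  have hk : ‖B x‖ ^ 2 ≤ (q + δ) * (2 * δ) := by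
    have h1 := re_inner_sub_real_smul hB x (B x) (q + δ)⁻¹
    rw [re_inner_self, hBf (B x), hBf x, hBf] at h1
    have h2 := hform (x - (((q + δ)⁻¹ : ℝ) : ℂ) • B x)
      (Submodule.sub_mem _ hxF₀ (Submodule.smul_mem _ _ hBx))
    have h3 := hpos (B x)
    have h4 : (q + δ)⁻¹ * ‖B x‖ ^ 2 ≤ 2 * δ := by
      rw [hx1] at h1
      have h5 : (q + δ)⁻¹ ^ 2 * ((q + δ) * ‖B x‖ ^ 2) = (q + δ)⁻¹ * ‖B x‖ ^ 2 := by
        field_simp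
      have h6 : 0 ≤ (q + δ)⁻¹ ^ 2 * (inner ℂ (R (B x)) (B x)).re := by positivity
      rw [mul_sub, h5] at h1
      linarith
    rwa [inv_mul_le_iff₀ hC] at h4
  have hk' : ‖B x‖ ≤ ε / 2 := by
    refine abs_le_of_sq_le_sq' ?_ (by positivity) |>.2
    refine hk.trans (le_trans ?_ hδs)
    gcongr
  have h7 : R x - (q : ℂ) • x = (δ : ℂ) • x - B x := by
    rw [hBa]
    push_cast
    module
  rw [h7]
  refine (norm_sub_le _ _).trans ?_
  rw [norm_smul, hx1, Complex.norm_real, Real.norm_of_nonneg hδ.le]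
  linarith

/-- If `A` is self-adjoint and nonnegative, and `T` is closed with real part contained in `A`, then
the essential spectrum of `T` lies to the right of the bottom of the essential spectrum of `A`. -/
theorem infEss_le_etaEss [CompleteSpace E] {A T : E →ₗ.[ℂ] E} (hA : IsSelfAdjoint A)
    (hpos : ∀ p ∈ A.graph, 0 ≤ (inner ℂ p.1 p.2).re) (hT : T.IsClosed)
    (hre : ∀ p ∈ T.graph, ∃ y, (p.1, y) ∈ A.graph ∧ (inner ℂ p.1 y).re = (inner ℂ p.1 p.2).re) :
    infEss A ≤ etaEss T := by
  refine le_iInf₂ fun z hz => ?_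
  -- Otherwise the form of `A`, which is the real part of that of `T`, exceeds `Re z + c` on unit
  -- vectors of `Fᗮ`; then `‖(T - z) f‖ ≥ c ‖f‖` there.
  have hweyl : ∀ F : Submodule ℂ E, FiniteDimensional ℂ F → ∀ c : ℝ, 0 < c →
      ∃ p ∈ A.graph, p.1 ∈ Fᗮ ∧ ‖p.1‖ = 1 ∧ (inner ℂ p.1 p.2).re ≤ z.re + c := by
    intro F hF c hc
    by_contra! hcon
    refine notMem_essSpectrum_of_bound hT F hc ?_ hz
    intro p hp hpF
    rcases eq_or_ne p.1 0 with h0 | h0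
    · simp [h0]
    have hn : 0 < ‖p.1‖ := norm_pos_iff.2 h0
    obtain ⟨y, hy, hyre⟩ := hre p hp
    have h1 := hcon ((((‖p.1‖⁻¹ : ℝ) : ℂ) • (p.1, y))) (Submodule.smul_mem _ _ hy)
      (Submodule.smul_mem _ _ hpF)
      (by rw [Prod.smul_fst, norm_smul, Complex.norm_real, norm_inv, norm_norm,
        inv_mul_cancel₀ hn.ne'])
    rw [Prod.smul_fst, Prod.smul_snd, inner_smul_left, inner_smul_right, Complex.conj_ofReal,
      Complex.re_ofReal_mul, Complex.re_ofReal_mul, ← mul_assoc, ← mul_inv, lt_inv_mul_iff₀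
      (by positivity), hyre] at h1
    have h2 : (inner ℂ p.1 (p.2 - z • p.1)).re = (inner ℂ p.1 p.2).re - z.re * ‖p.1‖ ^ 2 := by
      rw [inner_sub_right, inner_smul_right, inner_self_eq_norm_sq_to_K, Complex.sub_re]
      norm_cast
      congr 1
      exact Complex.re_mul_ofReal z _
    have h3 := (Complex.re_le_norm _).trans (norm_inner_le_norm (𝕜 := ℂ) p.1 (p.2 - z • p.1))
    by_contra! h4
    nlinarith
  have ha : 0 ≤ z.re := le_of_forall_pos_le_add fun c hc => by
    obtain ⟨p, hp, -, -, h⟩ := hweyl ⊥ inferInstance c hc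
    exact (hpos p hp).trans h
  obtain ⟨R, hR, hRpos, hRA, hRA'⟩ := exists_resolvent hA hpos
  obtain ⟨q, hpq, hq⟩ := exists_approx_eigenvalue hR hRpos (p := (1 + z.re)⁻¹) (by positivity) <| by
    intro F hF c hc
    obtain ⟨p, hp, hpF, hp1, hpz⟩ := hweyl F hF c hc
    refine ⟨p.1, hpF, hp1, ?_⟩
    set s := 1 + (inner ℂ p.1 p.2).re with hs
    have hs1 : 1 ≤ s := by linarith [hpos p hp]
    -- For a unit vector `x` and `u = (A + 1) x`, so `R u = x`, the form of `R` at `u - s x` is `s -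
    -- 2 s + s² (R x, x)`, where `s = Re (x, u)`. Its nonnegativity is `(R x, x) ≥ 1 / s`.
    have h1 := re_inner_sub_real_smul hR (p.2 + p.1) p.1 s
    rw [hRA' p hp, re_inner_self, inner_add_right, Complex.add_re, re_inner_self, hp1] at h1
    have h2 := hRpos (p.2 + p.1 - (s : ℂ) • p.1)
    have h3 : s⁻¹ ≤ (inner ℂ (R p.1) p.1).re := by
      rw [inv_le_iff_one_le_mul₀' (by linarith)]
      have h4 : s * 1 ≤ s * (s * (inner ℂ (R p.1) p.1).re) := by nlinarith
      exact le_of_mul_le_mul_left h4 (by linarith)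
    refine le_trans ?_ h3
    have h5 : (1 + z.re + c)⁻¹ ≤ s⁻¹ := by
      gcongr
      linarith
    refine le_trans ?_ h5
    rw [sub_le_iff_le_add, inv_le_iff_one_le_mul₀' (by positivity)]
    have h6 : (1 + z.re) * (1 + z.re + c)⁻¹ = 1 - c * (1 + z.re + c)⁻¹ := by
      field_simp
      ring
    have h7 : (1 + z.re + c)⁻¹ ≤ 1 := inv_le_one_of_one_le₀ (by linarith)
    rw [mul_add, h6]
    nlinarith
  have hp0 : 0 < (1 + z.re)⁻¹ := by positivity
  have hq0 : 0 < q := hp0.trans_le hpq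
  have hqz : q⁻¹ - 1 ≤ z.re := by
    have := inv_anti₀ hp0 hpq
    rw [inv_inv] at this
    linarith
  have hmem : ((q⁻¹ - 1 : ℝ) : ℂ) ∈ essSpectrum A := by
    by_contra hcon
    obtain ⟨F, hF, c, hc, h⟩ := exists_bound_of_notMem_essSpectrum hA.isClosed hcon
    -- Half the threshold below which `c (q - ε) ≤ ε / q` fails. That inequality would follow from
    -- the lower bound at `R x`, since `(A - (1 / q - 1)) R x = -(R x - q x) / q`.
    set ε := c * q / (q⁻¹ + c) / 2 with hε
    have hε0 : 0 < ε := by positivity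
    obtain ⟨x, hx, hx1, hxq⟩ := hq (F.map R.toLinearMap) inferInstance ε hε0
    -- By symmetry of `R`, orthogonality of `x` to `R F` gives `R x ∈ Fᗮ`.
    have h1 := h _ (hRA x) fun y hy => by
      rw [← hR]
      exact hx _ (Submodule.mem_map_of_mem hy)
    have h2 : x - R x - ((q⁻¹ - 1 : ℝ) : ℂ) • R x = -((q⁻¹ : ℝ) : ℂ) • (R x - (q : ℂ) • x) := by
      have : ((q⁻¹ : ℝ) : ℂ) * q = 1 := by
        rw [← Complex.ofReal_mul, inv_mul_cancel₀ hq0.ne', Complex.ofReal_one]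
      rw [neg_smul, smul_sub, smul_smul, this]
      push_cast
      module
    dsimp only at h1
    rw [h2, norm_smul, norm_neg, Complex.norm_real, Real.norm_of_nonneg (by positivity)] at h1
    have h3 : q - ε ≤ ‖R x‖ := by
      have h4 := norm_sub_norm_le ((q : ℂ) • x) (R x)
      rw [norm_sub_rev, norm_smul, hx1, Complex.norm_real, Real.norm_of_nonneg hq0.le] at h4
      linarith
    have h5 : c * (q - ε) ≤ q⁻¹ * ε :=
      (mul_le_mul_of_nonneg_left h3 hc.le).trans
        (h1.trans (mul_le_mul_of_nonneg_left hxq (by positivity)))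
    have h6 : (q⁻¹ + c) * ε = c * q / 2 := by
      rw [hε]
      field_simp
    have h7 : 0 < c * q := by positivity
    nlinarith
  have hle : infEss A ≤ ((q⁻¹ - 1 : ℝ) : EReal) := iInf₂_le (q⁻¹ - 1) hmem
  exact hle.trans (EReal.coe_le_coe_iff.2 hqz)

end UnboundedOp

end

noncomputable section

namespace UnboundedOp

variable {E : Type*} [NormedAddCommGroup E] [InnerProductSpace ℂ E]

/-! ### Bounded perturbations -/

lemma mem_graph_vadd (K : E →ₗ[ℂ] E) (A : E →ₗ.[ℂ] E) (p : E × E) :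
    p ∈ (K +ᵥ A).graph ↔ (p.1, p.2 - K p.1) ∈ A.graph := by
  simp only [LinearPMap.mem_graph_iff]
  constructor
  · rintro ⟨x, hx1, hx2⟩
    rw [LinearPMap.vadd_apply] at hx2
    exact ⟨x, hx1, by rw [← hx1, ← hx2]; abel⟩
  · rintro ⟨x, hx1, hx2⟩
    refine ⟨x, hx1, ?_⟩
    rw [LinearPMap.vadd_apply]
    rw [hx2, hx1]
    abel

/-- The shear `(x, y) ↦ (x, y - K x)`. -/
def shear (K : E →L[ℂ] E) : E × E ≃ₜ E × E where
  toFun p := (p.1, p.2 - K p.1)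
  invFun p := (p.1, p.2 + K p.1)
  left_inv p := by simp
  right_inv p := by simp
  continuous_toFun := by fun_prop
  continuous_invFun := by fun_prop

/-- Adding `K` acts on graphs through the shear, a homeomorphism, and so commutes with closure. -/
lemma closure_graph_vadd (K : E →L[ℂ] E) {A : E →ₗ.[ℂ] E} (hA : A.IsClosable) :
    (K.toLinearMap +ᵥ A).graph.topologicalClosure = (K.toLinearMap +ᵥ A.closure).graph := by
  have h : ∀ B : E →ₗ.[ℂ] E, ((K.toLinearMap +ᵥ B).graph : Set (E × E)) =
      shear K ⁻¹' (B.graph : Set (E × E)) := fun B => Set.ext fun p => mem_graph_vadd _ B p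
  apply SetLike.coe_injective
  rw [Submodule.topologicalClosure_coe, h, h, ← (shear K).preimage_closure,
    ← hA.graph_closure_eq_closure_graph, Submodule.topologicalClosure_coe]

lemma isClosable_vadd (K : E →L[ℂ] E) {A : E →ₗ.[ℂ] E} (hA : A.IsClosable) :
    (K.toLinearMap +ᵥ A).IsClosable :=
  ⟨_, closure_graph_vadd K hA⟩

lemma closure_vadd (K : E →L[ℂ] E) {A : E →ₗ.[ℂ] E} (hA : A.IsClosable) :
    (K.toLinearMap +ᵥ A).closure = K.toLinearMap +ᵥ A.closure := by
  apply LinearPMap.eq_of_eq_graph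
  rw [← (isClosable_vadd K hA).graph_closure_eq_closure_graph, closure_graph_vadd K hA]

variable [CompleteSpace E]

lemma adjoint_vadd {K : E →ₗ[ℂ] E} (hK : ∀ x y, inner ℂ (K x) y = -inner ℂ x (K y))
    {A : E →ₗ.[ℂ] E} (hA : Dense (A.domain : Set E)) :
    (K +ᵥ A).adjoint = (-K) +ᵥ A.adjoint := by
  apply LinearPMap.eq_of_eq_graph
  ext p
  rw [mem_graph_vadd, LinearPMap.adjoint_graph_eq_graph_adjoint hA,
    LinearPMap.adjoint_graph_eq_graph_adjoint (T := K +ᵥ A) hA, Submodule.mem_adjoint_iff,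
    Submodule.mem_adjoint_iff]
  constructor
  · intro h a b hab
    have := h a (b + K a) ((mem_graph_vadd K A _).2 (by simpa using hab))
    rw [inner_add_left, hK] at this
    rw [LinearMap.neg_apply, sub_neg_eq_add, inner_add_right]
    linear_combination this
  · intro h a b hab
    have := h a (b - K a) ((mem_graph_vadd K A _).1 hab)
    rw [inner_sub_left, hK, LinearMap.neg_apply, inner_sub_right, inner_neg_right] at this
    linear_combination this

/-- The relation defining the adjoint is a closed condition on the graph of `A`. -/
lemma adjoint_closure {A : E →ₗ.[ℂ] E} (hA : Dense (A.domain : Set E)) (hc : A.IsClosable) :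
    A.closure.adjoint = A.adjoint := by
  have hA' : Dense (A.closure.domain : Set E) := hA.mono A.le_closure.1
  apply LinearPMap.eq_of_eq_graph
  ext p
  rw [LinearPMap.adjoint_graph_eq_graph_adjoint hA, LinearPMap.adjoint_graph_eq_graph_adjoint hA',
    Submodule.mem_adjoint_iff, Submodule.mem_adjoint_iff]
  refine ⟨fun h a b hab => h a b (LinearPMap.le_graph_of_le A.le_closure hab), fun h a b hab => ?_⟩
  rw [← hc.graph_closure_eq_closure_graph] at hab
  have hcl : IsClosed {q : E × E | inner ℂ q.2 p.1 - inner ℂ q.1 p.2 = 0} :=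
    isClosed_eq (by fun_prop) continuous_const
  exact closure_minimal (fun q hq => h q.1 q.2 hq) hcl hab

/-- By convention `closure` leaves a non-closable operator unchanged; if the result is self-adjoint,
the operator was closed after all. -/
lemma isClosable_of_isEssentiallySelfAdjoint {A : E →ₗ.[ℂ] E} (hA : IsEssentiallySelfAdjoint A) :
    A.IsClosable := by
  by_contra hcon
  have h : IsSelfAdjoint A.closure := hA
  rw [LinearPMap.closure_def' hcon] at h
  exact hcon h.isClosed.isClosable

/-- The comparison of essential spectra for `K + A`, where `A` is nonnegative and essentially
self-adjoint, and `K` is bounded and skew-adjoint. -/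
theorem isClosable_and_infEss_le_etaEss_vadd {A : E →ₗ.[ℂ] E} (hA : IsEssentiallySelfAdjoint A)
    (hdense : Dense (A.domain : Set E)) (hpos : ∀ x : A.domain, 0 ≤ (inner ℂ (x : E) (A x)).re)
    (K : E →L[ℂ] E) (hK : ∀ x y, inner ℂ (K x) y = -inner ℂ x (K y)) :
    (K.toLinearMap +ᵥ A).IsClosable ∧
      infEss ((1 / 2 : ℂ) • ((K.toLinearMap +ᵥ A).closure + (K.toLinearMap +ᵥ A).adjoint)) ≤
        etaEss (K.toLinearMap +ᵥ A).closure := by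
  have hc := isClosable_of_isEssentiallySelfAdjoint hA
  have hsa : IsSelfAdjoint A.closure := hA
  have hadj : A.adjoint = A.closure := by
    rw [← adjoint_closure hdense hc, LinearPMap.isSelfAdjoint_def.1 hsa]
  have hcl := (isClosable_vadd K hc).closure_isClosed
  refine ⟨isClosable_vadd K hc, ?_⟩
  have hS : (1 / 2 : ℂ) • ((K.toLinearMap +ᵥ A).closure + (K.toLinearMap +ᵥ A).adjoint) =
      A.closure := by
    rw [closure_vadd K hc, adjoint_vadd (K := K.toLinearMap) hK hdense, hadj]
    refine LinearPMap.ext ?_ fun x hx hx' => ?_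
    · exact inf_idem _
    · rw [LinearPMap.smul_apply, LinearPMap.add_apply, LinearPMap.vadd_apply,
        LinearPMap.vadd_apply]
      change (1 / 2 : ℂ) • (K x + A.closure ⟨x, hx'⟩ + (-K x + A.closure ⟨x, hx'⟩)) = _
      module
  rw [hS]
  refine infEss_le_etaEss hsa ?_ hcl ?_
  · intro p hp
    rw [← hc.graph_closure_eq_closure_graph] at hp
    have hcl : IsClosed {q : E × E | 0 ≤ (inner ℂ q.1 q.2).re} :=
      isClosed_le continuous_const (by fun_prop)
    refine closure_minimal (fun q hq => ?_) hcl hp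
    obtain ⟨x, hx1, hx2⟩ := A.mem_graph_iff.1 hq
    simp only [Set.mem_ofPred_eq, ← hx1, ← hx2]
    exact hpos x
  · intro p hp
    rw [closure_vadd K hc, mem_graph_vadd] at hp
    refine ⟨_, hp, ?_⟩
    have h1 : (inner ℂ p.1 (K p.1)).re = 0 := by
      have := congrArg Complex.re (hK p.1 p.1)
      rw [← inner_conj_symm, Complex.conj_re, Complex.neg_re] at this
      linarith
    rw [inner_sub_right, Complex.sub_re]
    change _ - (inner ℂ p.1 (K p.1)).re = _
    rw [h1, sub_zero]

end UnboundedOp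

end

noncomputable section

namespace WeightedDigraph

variable {V : Type*} (G : WeightedDigraph V)

/-! ### Finitely supported functions -/

lemma inner_eq_sum {f g : G.L2} {s : Finset V} (hf : Function.support f ⊆ s) :
    inner ℂ f g = ∑ x ∈ s, (G.m x : ℂ) * (starRingEnd ℂ (f x) * g x) := by
  rw [L2.inner_def]
  refine tsum_eq_sum fun x hx => ?_
  have : f x = 0 := by
    by_contra h
    exact hx (hf h)
  simp [this]

lemma norm_sq_eq_sum {f : G.L2} {s : Finset V} (hf : Function.support f ⊆ s) :
    ‖f‖ ^ 2 = ∑ x ∈ s, G.m x * ‖f x‖ ^ 2 := by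
  rw [← UnboundedOp.re_inner_self, G.inner_eq_sum hf, Complex.re_sum]
  refine Finset.sum_congr rfl fun x _ => ?_
  rw [Complex.re_ofReal_mul, mul_comm (starRingEnd ℂ _), Complex.mul_conj, Complex.ofReal_re,
    Complex.normSq_eq_norm_sq]

lemma dense_finSupp : Dense (G.finSupp : Set G.L2) := by
  classical
  rw [Submodule.dense_iff_topologicalClosure_eq_top, Submodule.topologicalClosure_eq_top_iff,
    Submodule.eq_bot_iff]
  intro f hf
  ext x
  have hs : Function.support (Pi.single x 1 : V → ℂ) ⊆ ({x} : Finset V) := by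
    simp
  have hfin := (Finset.finite_toSet {x}).subset hs
  let d : G.L2 := L2.mk (Pi.single x 1) (G.summable_of_support_finite hfin)
  have h1 := hf d hfin
  rw [G.inner_eq_sum (f := d) hs] at h1
  simpa [d, (G.m_pos x).ne'] using h1

lemma laplacianOf_mem_finSupp {w : V → V → ℝ} (hw : ∀ x, {y | w x y ≠ 0 ∨ w y x ≠ 0}.Finite)
    (f : G.finSupp) : G.laplacianOf w hw f ∈ G.finSupp :=
  G.lapFun_support hw f.2

/-! ### The symmetric part -/

/-- The quadratic form of the Laplacian of a symmetric weight is nonnegative. -/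
lemma re_inner_laplacianOf_nonneg {w : V → V → ℝ}
    (hw : ∀ x, {y | w x y ≠ 0 ∨ w y x ≠ 0}.Finite) (hw0 : ∀ x y, 0 ≤ w x y)
    (hsymm : ∀ x y, w x y = w y x) (f : G.finSupp) :
    0 ≤ (inner ℂ (f : G.L2) (G.laplacianOf w hw f)).re := by
  have hf : (Function.support (f : G.L2)).Finite := f.2
  -- The support together with its neighbours: all double sums then run over the square `U × U` and
  -- their order may be exchanged.
  set U : Finset V := (hf.union (hf.biUnion fun y _ => hw y)).toFinset with hU
  have hfU : Function.support (f : G.L2) ⊆ U := fun x hx => by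
    simp only [hU, Set.Finite.coe_toFinset]
    exact Or.inl hx
  have hnb : ∀ x, (f : G.L2) x ≠ 0 → ∀ y ∉ U, w x y = 0 := fun x hx y hy => by
    by_contra h
    refine hy ?_
    rw [hU, Set.Finite.mem_toFinset]
    exact Or.inr (Set.mem_biUnion hx (Or.inl h))
  have hterm : ∀ x, ((G.m x : ℂ) * (starRingEnd ℂ ((f : G.L2) x) *
      G.laplacianOf w hw f x)).re =
      ∑ y ∈ U, w x y * (starRingEnd ℂ ((f : G.L2) x) * ((f : G.L2) x - (f : G.L2) y)).re := by
    intro x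
    by_cases hx : (f : G.L2) x = 0
    · simp [hx]
    have h1 : G.laplacianOf w hw f x =
        1 / (G.m x : ℂ) * ∑ y ∈ U, (w x y : ℂ) * ((f : G.L2) x - (f : G.L2) y) := by
      change G.lapFun w _ x = _
      rw [lapFun, tsum_eq_sum fun y hy => by rw [hnb x hx y hy]; simp]
    have hm : (G.m x : ℂ) ≠ 0 := by exact_mod_cast (G.m_pos x).ne'
    have h2 : (G.m x : ℂ) * (starRingEnd ℂ ((f : G.L2) x) * G.laplacianOf w hw f x) =
        ∑ y ∈ U, (w x y : ℂ) * (starRingEnd ℂ ((f : G.L2) x) *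
          ((f : G.L2) x - (f : G.L2) y)) := by
      rw [h1, mul_left_comm, ← mul_assoc (G.m x : ℂ), mul_one_div_cancel hm, one_mul,
        Finset.mul_sum]
      exact Finset.sum_congr rfl fun y _ => mul_left_comm _ _ _
    rw [h2, Complex.re_sum]
    exact Finset.sum_congr rfl fun y _ => Complex.re_ofReal_mul _ _
  rw [G.inner_eq_sum hfU, Complex.re_sum, Finset.sum_congr rfl fun x _ => hterm x]
  have hzero : ∑ x ∈ U, ∑ y ∈ U, w x y * (‖(f : G.L2) x‖ ^ 2 - ‖(f : G.L2) y‖ ^ 2) = 0 := by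
    simp only [mul_sub, Finset.sum_sub_distrib]
    rw [sub_eq_zero]
    conv_rhs => rw [Finset.sum_comm]
    exact Finset.sum_congr rfl fun x _ => Finset.sum_congr rfl fun y _ => by rw [hsymm x y]
  -- This is `|a - c|² ≥ 0`. The lower bound is antisymmetric in `a` and `c`, so its sum against a
  -- symmetric weight vanishes.
  have hle : ∀ a c : ℂ, (‖a‖ ^ 2 - ‖c‖ ^ 2) / 2 ≤ (starRingEnd ℂ a * (a - c)).re := fun a c => by
    simp only [← Complex.normSq_eq_norm_sq, Complex.normSq_apply, Complex.mul_re, Complex.conj_re,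
      Complex.conj_im, Complex.sub_re, Complex.sub_im]
    nlinarith [sq_nonneg (a.re - c.re), sq_nonneg (a.im - c.im)]
  calc (0 : ℝ) = (∑ x ∈ U, ∑ y ∈ U, w x y * (‖(f : G.L2) x‖ ^ 2 - ‖(f : G.L2) y‖ ^ 2)) / 2 := by
        rw [hzero, zero_div]
    _ = ∑ x ∈ U, ∑ y ∈ U, w x y * ((‖(f : G.L2) x‖ ^ 2 - ‖(f : G.L2) y‖ ^ 2) / 2) := by
        simp only [Finset.sum_div, mul_div_assoc]
    _ ≤ _ := Finset.sum_le_sum fun x _ => Finset.sum_le_sum fun y _ =>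
        mul_le_mul_of_nonneg_left (hle _ _) (hw0 x y)

lemma finite_symmWeight (x : V) :
    {y | (G.b x y + G.b y x) / 2 ≠ 0 ∨ (G.b y x + G.b x y) / 2 ≠ 0}.Finite :=
  (G.finite_weight x).subset fun y hy => by
    by_contra hcon
    simp only [Set.mem_ofPred_eq, not_or, not_not] at hcon
    simp [hcon.1, hcon.2] at hy

lemma opH_domain : G.opH.domain = G.finSupp := inf_idem _

lemma summable_weight_mul (x : V) (c : V → ℂ) : Summable fun y => (G.b x y : ℂ) * c y :=
  summable_of_hasFiniteSupport
    ((G.finite_weight x).subset fun y hy => Or.inl fun h => hy (by simp [h]))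

lemma summable_weight_mul' (x : V) (c : V → ℂ) : Summable fun y => (G.b y x : ℂ) * c y :=
  summable_of_hasFiniteSupport
    ((G.finite_weight x).subset fun y hy => Or.inr fun h => hy (by simp [h]))

lemma L2.sub_apply (f g : G.L2) (x : V) : (f - g) x = f x - g x := rfl

lemma opH_eq (f : G.opH.domain) (hf : (f : G.L2) ∈ G.finSupp) :
    G.opH f = (1 / 2 : ℂ) • (G.laplacian ⟨f, hf⟩ + G.formalAdjointLaplacian ⟨f, hf⟩) :=
  (LinearPMap.smul_apply (1 / 2 : ℂ) _ f).trans (congrArg _ (LinearPMap.add_apply _ _ f))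

/-- With a single symmetric weight, the form estimate above applies to `H`. -/
lemma opH_apply (f : G.opH.domain) (hf : (f : G.L2) ∈ G.finSupp) :
    G.opH f = G.laplacianOf (fun x y => (G.b x y + G.b y x) / 2) G.finite_symmWeight ⟨f, hf⟩ := by
  ext x
  rw [G.opH_eq f hf]
  change (1 / 2 : ℂ) * (G.lapFun G.b (f : G.L2) x + G.lapFun (fun x y => G.b y x) (f : G.L2) x) =
    G.lapFun (fun x y => (G.b x y + G.b y x) / 2) (f : G.L2) x
  simp only [lapFun]
  rw [← mul_add, ← (G.summable_weight_mul x _).tsum_add (G.summable_weight_mul' x _),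
    mul_left_comm, ← tsum_mul_left]
  congr 1
  refine tsum_congr fun y => ?_
  push_cast
  ring

/-! ### The skew-symmetric part -/

/-- The operator `(Δ - Δ') / 2` on the finitely supported functions. -/
def skewPart : G.finSupp →ₗ[ℂ] G.L2 :=
  (1 / 2 : ℂ) • ((show G.finSupp →ₗ[ℂ] G.L2 from G.laplacian.toFun) -
    (show G.finSupp →ₗ[ℂ] G.L2 from G.formalAdjointLaplacian.toFun))

lemma skewPart_eq (f : G.finSupp) :
    G.skewPart f = (1 / 2 : ℂ) • (G.laplacian f - G.formalAdjointLaplacian f) := rfl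

/-- The antisymmetric kernel of `(Δ - Δ') / 2`, up to the vertex weight. -/
def skewKernel (x y : V) : ℝ := (G.b y x - G.b x y) / 2

lemma skewKernel_neg (x y : V) : G.skewKernel y x = -G.skewKernel x y := by
  simp only [skewKernel]
  ring

lemma skewPart_mem_finSupp (f : G.finSupp) : G.skewPart f ∈ G.finSupp :=
  G.finSupp.smul_mem (1 / 2 : ℂ) (G.finSupp.sub_mem (G.laplacianOf_mem_finSupp G.finite_weight f)
    (G.laplacianOf_mem_finSupp (w := fun x y => G.b y x) _ f))

variable {G}

/-- By (β) the terms containing `f x` cancel, so only the kernel remains. -/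
lemma skewPart_apply (hβ : G.AssumptionBeta) (f : G.finSupp) (x : V) {s : Finset V}
    (hs : Function.support (f : G.L2) ⊆ s) :
    (G.m x : ℂ) * G.skewPart f x = ∑ y ∈ s, (G.skewKernel x y : ℂ) * (f : G.L2) y := by
  have h1 : G.skewPart f x =
      1 / 2 * (G.lapFun G.b (f : G.L2) x - G.lapFun (fun x y => G.b y x) (f : G.L2) x) := by
    rw [G.skewPart_eq, L2.smul_apply, L2.sub_apply]
    rfl
  have hm : (G.m x : ℂ) ≠ 0 := by exact_mod_cast (G.m_pos x).ne'
  have hβ' : ∑' y, (G.b x y : ℂ) = ∑' y, (G.b y x : ℂ) := by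
    rw [← Complex.ofReal_tsum, ← Complex.ofReal_tsum, hβ x]
  have h2 : ∑' y, (G.b x y : ℂ) * ((f : G.L2) x - (f : G.L2) y) =
      (∑' y, (G.b x y : ℂ)) * (f : G.L2) x - ∑ y ∈ s, (G.b x y : ℂ) * (f : G.L2) y := by
    simp only [mul_sub]
    rw [(G.summable_weight_mul x _).tsum_sub (G.summable_weight_mul x _), tsum_mul_right]
    congr 1
    refine tsum_eq_sum fun y hy => ?_
    rw [Function.notMem_support.1 fun h => hy (hs h), mul_zero]
  have h3 : ∑' y, (G.b y x : ℂ) * ((f : G.L2) x - (f : G.L2) y) =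
      (∑' y, (G.b y x : ℂ)) * (f : G.L2) x - ∑ y ∈ s, (G.b y x : ℂ) * (f : G.L2) y := by
    simp only [mul_sub]
    rw [(G.summable_weight_mul' x _).tsum_sub (G.summable_weight_mul' x _), tsum_mul_right]
    congr 1
    refine tsum_eq_sum fun y hy => ?_
    rw [Function.notMem_support.1 fun h => hy (hs h), mul_zero]
  have h4 : ∑ y ∈ s, (G.skewKernel x y : ℂ) * (f : G.L2) y =
      1 / 2 * (∑ y ∈ s, (G.b y x : ℂ) * (f : G.L2) y - ∑ y ∈ s, (G.b x y : ℂ) * (f : G.L2) y) := by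
    rw [← Finset.sum_sub_distrib, Finset.mul_sum]
    refine Finset.sum_congr rfl fun y _ => ?_
    simp only [skewKernel]
    push_cast
    ring
  rw [h1, h4]
  simp only [lapFun]
  rw [h2, h3, hβ']
  field_simp
  ring

lemma inner_skewPart (hβ : G.AssumptionBeta) (f g : G.finSupp) {s : Finset V}
    (hf : Function.support (f : G.L2) ⊆ s) (hg : Function.support (g : G.L2) ⊆ s) :
    inner ℂ (g : G.L2) (G.skewPart f) = ∑ x ∈ s, ∑ y ∈ s,
      (G.skewKernel x y : ℂ) * (starRingEnd ℂ ((g : G.L2) x) * (f : G.L2) y) := by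
  rw [G.inner_eq_sum hg]
  refine Finset.sum_congr rfl fun x _ => ?_
  rw [mul_left_comm, skewPart_apply hβ f x hf, Finset.mul_sum]
  exact Finset.sum_congr rfl fun y _ => mul_left_comm _ _ _

lemma exists_finset_support (f g : G.finSupp) : ∃ s : Finset V,
    Function.support (f : G.L2) ⊆ s ∧ Function.support (g : G.L2) ⊆ s := by
  have hf : (Function.support (f : G.L2)).Finite := f.2
  have hg : (Function.support (g : G.L2)).Finite := g.2
  refine ⟨(hf.union hg).toFinset, ?_, ?_⟩ <;> simp

lemma inner_skewPart_left (hβ : G.AssumptionBeta) (f g : G.finSupp) :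
    inner ℂ (G.skewPart f) (g : G.L2) = -inner ℂ (f : G.L2) (G.skewPart g) := by
  obtain ⟨s, hf, hg⟩ := exists_finset_support f g
  rw [← inner_conj_symm, inner_skewPart hβ f g hf hg, inner_skewPart hβ g f hg hf, map_sum,
    Finset.sum_congr rfl fun x _ => map_sum _ _ _, Finset.sum_comm, ← Finset.sum_neg_distrib]
  refine Finset.sum_congr rfl fun x _ => ?_
  rw [← Finset.sum_neg_distrib]
  refine Finset.sum_congr rfl fun y _ => ?_
  rw [G.skewKernel_neg x y, map_mul, map_mul, Complex.conj_conj, Complex.conj_ofReal]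
  push_cast
  ring

lemma sum_abs_skewKernel_le {M : ℝ} (hM : ∀ x, ∑' y, |G.b x y - G.b y x| ≤ M * G.m x) (x : V)
    (s : Finset V) : ∑ y ∈ s, |G.skewKernel x y| ≤ M / 2 * G.m x := by
  have h1 : ∀ y, |G.skewKernel x y| = |G.b x y - G.b y x| / 2 := fun y => by
    rw [skewKernel, abs_div, abs_sub_comm, abs_two]
  have hsum : Summable fun y => |G.b x y - G.b y x| :=
    summable_of_hasFiniteSupport <| (G.finite_weight x).subset fun y hy => by
      by_contra hcon
      simp only [Set.mem_ofPred_eq, not_or, not_not] at hcon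
      simp [hcon.1, hcon.2] at hy
  simp only [h1, ← Finset.sum_div]
  have := (hsum.sum_le_tsum s fun y _ => abs_nonneg _).trans (hM x)
  linarith

/-- Schur test: after `2 |g x| |f y| ≤ |g x|² + |f y|²`, row sums of the absolute kernel control one
term and column sums the other; by antisymmetry both are at most `M / 2 * m`. -/
lemma re_inner_skewPart_le (hβ : G.AssumptionBeta) {M : ℝ}
    (hM : ∀ x, ∑' y, |G.b x y - G.b y x| ≤ M * G.m x) (f g : G.finSupp) :
    (inner ℂ (g : G.L2) (G.skewPart f)).re ≤ M / 4 * (‖(g : G.L2)‖ ^ 2 + ‖(f : G.L2)‖ ^ 2) := by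
  obtain ⟨s, hf, hg⟩ := exists_finset_support f g
  rw [inner_skewPart hβ f g hf hg, G.norm_sq_eq_sum hf, G.norm_sq_eq_sum hg]
  have hone : ∀ u : V → ℂ, ∑ x ∈ s, ∑ y ∈ s, |G.skewKernel x y| * ‖u x‖ ^ 2 ≤
      M / 2 * ∑ x ∈ s, G.m x * ‖u x‖ ^ 2 := fun u => by
    rw [Finset.mul_sum]
    refine Finset.sum_le_sum fun x _ => ?_
    rw [← Finset.sum_mul, ← mul_assoc]
    exact mul_le_mul_of_nonneg_right (sum_abs_skewKernel_le hM x s) (sq_nonneg _)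
  have htwo : ∑ x ∈ s, ∑ y ∈ s, |G.skewKernel x y| * ‖(f : G.L2) y‖ ^ 2 ≤
      M / 2 * ∑ x ∈ s, G.m x * ‖(f : G.L2) x‖ ^ 2 := by
    rw [Finset.sum_comm]
    refine le_trans (le_of_eq ?_) (hone (f : G.L2))
    refine Finset.sum_congr rfl fun x _ => Finset.sum_congr rfl fun y _ => ?_
    rw [G.skewKernel_neg x y, abs_neg]
  calc _ ≤ ‖∑ x ∈ s, ∑ y ∈ s,
        (G.skewKernel x y : ℂ) * (starRingEnd ℂ ((g : G.L2) x) * (f : G.L2) y)‖ :=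
        Complex.re_le_norm _
    _ ≤ ∑ x ∈ s, ∑ y ∈ s, |G.skewKernel x y| * (‖(g : G.L2) x‖ * ‖(f : G.L2) y‖) := by
        refine norm_sum_le_of_le _ fun x _ => norm_sum_le_of_le _ fun y _ => le_of_eq ?_
        rw [norm_mul, norm_mul, Complex.norm_real, Real.norm_eq_abs, RCLike.norm_conj]
    _ ≤ ∑ x ∈ s, ∑ y ∈ s, (|G.skewKernel x y| * ‖(g : G.L2) x‖ ^ 2 +
        |G.skewKernel x y| * ‖(f : G.L2) y‖ ^ 2) / 2 := by
        refine Finset.sum_le_sum fun x _ => Finset.sum_le_sum fun y _ => ?_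
        rw [← mul_add, mul_div_assoc]
        refine mul_le_mul_of_nonneg_left ?_ (abs_nonneg _)
        linarith [two_mul_le_add_sq ‖(g : G.L2) x‖ ‖(f : G.L2) y‖]
    _ = (∑ x ∈ s, ∑ y ∈ s, |G.skewKernel x y| * ‖(g : G.L2) x‖ ^ 2 +
        ∑ x ∈ s, ∑ y ∈ s, |G.skewKernel x y| * ‖(f : G.L2) y‖ ^ 2) / 2 := by
        simp only [← Finset.sum_div, Finset.sum_add_distrib]
    _ ≤ _ := by linarith [hone (g : G.L2)]

lemma norm_skewPart_le (hβ : G.AssumptionBeta) {M : ℝ} (hM0 : 0 < M)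
    (hM : ∀ x, ∑' y, |G.b x y - G.b y x| ≤ M * G.m x) (f : G.finSupp) :
    ‖G.skewPart f‖ ≤ M / 2 * ‖(f : G.L2)‖ := by
  -- Testing against `g = (2 / M) K f`, admissible because `K f` has finite support; the factor
  -- makes `‖g‖ = ‖f‖` in the extremal case `‖K f‖ = (M / 2) ‖f‖`.
  have h := re_inner_skewPart_le hβ hM f
    ⟨((2 / M : ℝ) : ℂ) • G.skewPart f, G.finSupp.smul_mem _ (G.skewPart_mem_finSupp f)⟩
  dsimp only at h
  rw [inner_smul_left, Complex.conj_ofReal, Complex.re_ofReal_mul, UnboundedOp.re_inner_self,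
    norm_smul, Complex.norm_real, Real.norm_of_nonneg (by positivity), mul_pow] at h
  have h1 : M / 4 * ((2 / M) ^ 2 * ‖G.skewPart f‖ ^ 2 + ‖(f : G.L2)‖ ^ 2) =
      1 / M * ‖G.skewPart f‖ ^ 2 + M / 4 * ‖(f : G.L2)‖ ^ 2 := by
    field_simp
    ring
  rw [h1] at h
  have h2 : 1 / M * ‖G.skewPart f‖ ^ 2 ≤ M / 4 * ‖(f : G.L2)‖ ^ 2 := by
    have : 2 / M * ‖G.skewPart f‖ ^ 2 = 2 * (1 / M * ‖G.skewPart f‖ ^ 2) := by ring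
    linarith
  rw [one_div, inv_mul_le_iff₀ hM0] at h2
  refine abs_le_of_sq_le_sq' ?_ (by positivity) |>.2
  linarith

/-- `(Δ - Δ') / 2` extends to a bounded skew-adjoint operator. -/
lemma exists_skew_extension (hβ : G.AssumptionBeta) (hγ : G.AssumptionGamma) :
    ∃ K : G.L2 →L[ℂ] G.L2, (∀ f : G.finSupp, K f = G.skewPart f) ∧
      ∀ f g, inner ℂ (K f) g = -inner ℂ f (K g) := by
  obtain ⟨M, hM0, hM⟩ := hγ
  have hdense : DenseRange G.finSupp.subtype := G.dense_finSupp.denseRange_val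
  have hK : ∀ f : G.finSupp, G.skewPart.extendOfNorm G.finSupp.subtype f = G.skewPart f := fun f =>
    LinearMap.extendOfNorm_eq hdense ⟨M / 2, norm_skewPart_le hβ hM0 hM⟩ f
  refine ⟨G.skewPart.extendOfNorm G.finSupp.subtype, hK, fun f g => ?_⟩
  refine hdense.induction_on₂
    (p := fun f g => inner ℂ (G.skewPart.extendOfNorm G.finSupp.subtype f) g =
      -inner ℂ f (G.skewPart.extendOfNorm G.finSupp.subtype g)) ?_ (fun f g => ?_) f g
  · exact isClosed_eq (by fun_prop) (by fun_prop)
  · rw [Submodule.subtype_apply, Submodule.subtype_apply, hK, hK]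
    exact inner_skewPart_left hβ f g

lemma laplacian_eq_vadd {K : G.L2 →ₗ[ℂ] G.L2} (hK : ∀ f : G.finSupp, K f = G.skewPart f) :
    G.laplacian = K +ᵥ G.opH := by
  refine LinearPMap.ext G.opH_domain.symm fun f hf hf' => ?_
  rw [LinearPMap.vadd_apply]
  change _ = K f + _
  rw [hK ⟨f, hf⟩]
  rw [G.skewPart_eq, G.opH_eq ⟨f, hf'⟩ hf]
  have h : ∀ u v : G.L2, u = (1 / 2 : ℂ) • (u - v) + (1 / 2 : ℂ) • (u + v) := fun u v => by module
  exact h _ _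

end WeightedDigraph

end

/-! ### The graph Laplacian as a skew-adjoint perturbation of `H` -/

theorem mainTheorem10 {V : Type*} [Countable V] (G : WeightedDigraph V)
    (hconn : G.Connected) (hout : G.HasOutEdges)
    (hβ : G.AssumptionBeta) (hγ : G.AssumptionGamma)
    (hH : UnboundedOp.IsEssentiallySelfAdjoint G.opH) :
    G.laplacian.IsClosable ∧
      UnboundedOp.infEss G.opS ≤ UnboundedOp.etaEss G.laplacian.closure := by
  obtain ⟨K, hK, hskew⟩ := WeightedDigraph.exists_skew_extension hβ hγ
  rw [WeightedDigraph.opS, WeightedDigraph.laplacian_eq_vadd (K := K.toLinearMap) hK]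
  refine UnboundedOp.isClosable_and_infEss_le_etaEss_vadd hH ?_ (fun f => ?_) K hskew
  · rw [G.opH_domain]
    exact G.dense_finSupp
  · have hf : (f : G.L2) ∈ G.finSupp := G.opH_domain ▸ f.2
    rw [G.opH_apply f hf]
    refine G.re_inner_laplacianOf_nonneg _ (fun x y => ?_) (fun x y => ?_) ⟨f, hf⟩
    · have := G.b_nonneg x y
      have := G.b_nonneg y x
      positivity
    · rw [add_comm]
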